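/- Let $\mathrm{G}$ be a discrete group. A left cocycle of $\mathrm{G}$ is a triple $(\mathcal{H},\alpha,b)$ consisting of a real Hilbert space $\mathcal{H}$, an action $\alpha$ of $\mathrm{G}$ on $\mathcal{H}$ by orthogonal transformations (a group homomorphism $\alpha:\mathrm{G}\to O(\mathcal{H})$), and a map $b:\mathrm{G}\to\mathcal{H}$ such that $\alpha_g(b(h)) = b(gh)-b(g)$ for all $g,h\in\mathrm{G}$. A right cocycle satisfies instead $\alpha_g(b(h)) = b(hg^{-1})-b(g^{-1})$ for all $g,h\in\mathrm{G}$. A (left or right) cocycle is called standard if $b$ is injective and well-separated, the latter meaning that $$\Delta = \inf_{b(g)\neq b(h)} \|b(g)-b(h)\|_{\mathcal{H}}^2 > 0$$ (with $\inf\emptyset=\infty$), and finite-dimensional if $\dim\mathcal{H}<\infty$. Theorem. If $\mathrm{G}$ has a finite-dimensional standard cocycle, left or right, then $\mathrm{G}$ is virtually abelian, that is, $\mathrm{G}$ has an abelian subgroup of finite index. -/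

import Mathlib

open scoped ENNReal

/-- `(H, α, b)` is a left cocycle of the group `G`: `α` is an action of `G` on the real Hilbert
space `H` by linear isometric automorphisms, and `α_g (b h) = b (g h) - b g`. -/
def IsLeftCocycle {G H : Type*} [Group G] [NormedAddCommGroup H] [InnerProductSpace ℝ H]
    (α : G →* (H ≃ₗᵢ[ℝ] H)) (b : G → H) : Prop :=
  ∀ g h : G, α g (b h) = b (g * h) - b g

/-- `(H, α, b)` is a right cocycle of the group `G`: `α_g (b h) = b (h g⁻¹) - b g⁻¹`. -/
def IsRightCocycle {G H : Type*} [Group G] [NormedAddCommGroup H] [InnerProductSpace ℝ H]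
    (α : G →* (H ≃ₗᵢ[ℝ] H)) (b : G → H) : Prop :=
  ∀ g h : G, α g (b h) = b (h * g⁻¹) - b g⁻¹

/-- The separation constant `Δ = inf_{b g ≠ b h} ‖b g - b h‖²`, as an extended nonnegative real
(so that the infimum over the empty set, for constant `b`, is `∞`). -/
noncomputable def separationConst {G H : Type*} [NormedAddCommGroup H] (b : G → H) : ℝ≥0∞ :=
  ⨅ (g : G) (h : G) (_ : b g ≠ b h), ENNReal.ofReal (‖b g - b h‖ ^ 2)

/-- The map `b` is well-separated: `Δ > 0`. -/
def IsWellSeparated {G H : Type*} [NormedAddCommGroup H] (b : G → H) : Prop :=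
  0 < separationConst b

/-- A cocycle map is standard if it is injective and well-separated. -/
def IsStandardCocycleMap {G H : Type*} [NormedAddCommGroup H] (b : G → H) : Prop :=
  Function.Injective b ∧ IsWellSeparated b

/-- A group is virtually abelian if it has an abelian subgroup of finite index. -/
def IsVirtuallyAbelian (G : Type*) [Group G] : Prop :=
  ∃ A : Subgroup G, (∀ x ∈ A, ∀ y ∈ A, x * y = y * x) ∧ A.FiniteIndex

/-!
A left cocycle makes `G` act on `H` by the affine isometries `x ↦ α g x + b g`, and `b` is the orbit
map of `0`. Since `b` is injective and well-separated, an element `g` with `b g` close to `0` is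
trivial (`IsLeftCocycle.exists_pos_eq_one_of_norm_lt`), so the theorem is a form of Bieberbach's
first theorem. The argument follows Oliver: elements whose rotation parts lie within `1/4` of the
identity commute with each other (`IsLeftCocycle.commute_of_movesAtMost`), so they generate an
abelian subgroup, which has finite index because the isometries of a finite-dimensional space are
covered by finitely many balls of radius `1/8` (`exists_finite_range_movesAtMost`).

Commutation is proved as follows. For such `g` and `h` the iterated commutators
`⁅g, ⁅g, … ⁅g, h⁆⁆⁆` have rotation and translation parts that shrink geometrically, so they are
eventually trivial. A rotation `A` that commutes with `⁅A, X⁆`, with `X` near the identity, commutes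
with `X`, because then all powers `⁅A, X⁆ ^ m = ⁅A ^ m, X⁆` are near the identity and isometries have
no small subgroups (`commute_of_commute_commutator`). Descending along the iterated commutators,
`α g` and `α h` commute, so `t = ⁅g, h⁆` acts as the translation by `b t`. The same descent applied
to `g, t` and to `h, t` shows that `α g` and `α h` fix `b t`. On the other hand `b t` is a sum of
elements of the ranges of `α g - 1` and `α h - 1`, which are orthogonal to the vectors fixed by
both; hence `b t = 0` and `t = 1`.

A right cocycle `b` becomes a left one on replacing `b` by `g ↦ b g⁻¹`.
-/

open Filter Topology
open scoped commutatorElement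

/-! ### Isometries close to the identity -/

/-- The linear isometry `A` is at distance at most `c` from the identity in operator norm. -/
def MovesAtMost {H : Type*} [NormedAddCommGroup H] [InnerProductSpace ℝ H]
    (c : ℝ) (A : H ≃ₗᵢ[ℝ] H) : Prop :=
  ∀ v, ‖A v - v‖ ≤ c * ‖v‖

section Isometries

variable {H : Type*} [NormedAddCommGroup H] [InnerProductSpace ℝ H] {A B X Z : H ≃ₗᵢ[ℝ] H}
  {c d : ℝ}

theorem MovesAtMost.mono (hA : MovesAtMost c A) (hcd : c ≤ d) : MovesAtMost d A := fun v =>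
  (hA v).trans (by gcongr)

theorem MovesAtMost.one (hc : 0 ≤ c) : MovesAtMost c (1 : H ≃ₗᵢ[ℝ] H) := fun v => by
  simpa using mul_nonneg hc (norm_nonneg v)

theorem MovesAtMost.inv (hA : MovesAtMost c A) : MovesAtMost c A⁻¹ := fun v => by
  have h := hA (A⁻¹ v)
  have h1 : A (A⁻¹ v) = v := A.apply_symm_apply v
  rw [h1, norm_sub_rev] at h
  simpa using h.trans_eq (by rw [LinearIsometryEquiv.norm_map])

theorem MovesAtMost.mul (hA : MovesAtMost c A) (hB : MovesAtMost d B) :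
    MovesAtMost (c + d) (A * B) := fun v => by
  have h := hA (B v)
  rw [LinearIsometryEquiv.norm_map] at h
  calc ‖A (B v) - v‖ = ‖(A (B v) - B v) + (B v - v)‖ := by congr 1; abel
    _ ≤ c * ‖v‖ + d * ‖v‖ := (norm_add_le _ _).trans (add_le_add h (hB v))
    _ = (c + d) * ‖v‖ := by ring

theorem MovesAtMost.conj (hA : MovesAtMost c A) (B : H ≃ₗᵢ[ℝ] H) :
    MovesAtMost c (B * A * B⁻¹) := fun v => by
  have h := hA (B⁻¹ v)
  have h1 : B (B⁻¹ v) = v := B.apply_symm_apply v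
  rw [LinearIsometryEquiv.norm_map] at h
  calc ‖B (A (B⁻¹ v)) - v‖ = ‖B (A (B⁻¹ v) - B⁻¹ v)‖ := by rw [map_sub, h1]
    _ ≤ c * ‖v‖ := by rwa [LinearIsometryEquiv.norm_map]

/-- The commutator estimate: `⁅A, B⁆ - 1` is `(A - 1) (B - 1) - (B - 1) (A - 1)` up to an isometry
on the right. -/
theorem MovesAtMost.commutator (hc : 0 ≤ c) (hd : 0 ≤ d) (hA : MovesAtMost c A)
    (hB : MovesAtMost d B) : MovesAtMost (2 * c * d) ⁅A, B⁆ := fun v => by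
  obtain ⟨w, rfl⟩ : ∃ w, v = (B * A) w :=
    ⟨(B * A)⁻¹ v, ((B * A).apply_symm_apply v).symm⟩
  have h1 : ⁅A, B⁆ ((B * A) w) = A (B w) := by
    change (⁅A, B⁆ * (B * A)) w = (A * B) w
    rw [commutatorElement_def]
    congr 1; group
  have h2 : ‖(B * A) w‖ = ‖w‖ := LinearIsometryEquiv.norm_map _ _
  have h3 : A (B w) - (B * A) w = (A (B w - w) - (B w - w)) - (B (A w - w) - (A w - w)) := by
    simp only [map_sub, LinearIsometryEquiv.coe_mul, Function.comp_apply]; abel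
  rw [h1, h2, h3]
  have h4 := (hA (B w - w)).trans (mul_le_mul_of_nonneg_left (hB w) hc)
  have h5 := (hB (A w - w)).trans (mul_le_mul_of_nonneg_left (hA w) hd)
  refine (norm_sub_le _ _).trans ((add_le_add h4 h5).trans_eq (by ring))

/-- Isometries have no small subgroups: if all powers of `Z` are at distance at most `c < 1` from
the identity, then `Z = 1`. -/
theorem eq_one_of_forall_movesAtMost_pow (hc : c < 1) (hZ : ∀ m : ℕ, MovesAtMost c (Z ^ m)) :
    Z = 1 := by
  have hpos : 0 < 2 - c := by linarith
  -- The identity `Z ^ 2 - 1 = 2 (Z - 1) + (Z - 1) ^ 2` improves any bound by a factor `2 - c > 1`.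
  have key : ∀ k m : ℕ, MovesAtMost (c * ((2 - c)⁻¹) ^ k) (Z ^ m) := by
    intro k
    induction k with
    | zero => simpa using hZ
    | succ k ih =>
      intro m v
      have h1 := ih (m + m) v
      have h2 := hZ m ((Z ^ m) v - v)
      rw [pow_add, LinearIsometryEquiv.coe_mul, Function.comp_apply] at h1
      have h3 : (2 : ℝ) • ((Z ^ m) v - v) =
          ((Z ^ m) ((Z ^ m) v) - v) - ((Z ^ m) ((Z ^ m) v - v) - ((Z ^ m) v - v)) := by
        rw [map_sub, two_smul]; abel
      have h4 : 2 * ‖(Z ^ m) v - v‖ ≤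
          c * ((2 - c)⁻¹) ^ k * ‖v‖ + c * ‖(Z ^ m) v - v‖ := by
        calc 2 * ‖(Z ^ m) v - v‖ = ‖(2 : ℝ) • ((Z ^ m) v - v)‖ := by simp [norm_smul]
          _ ≤ _ := by rw [h3]; exact (norm_sub_le _ _).trans (add_le_add h1 h2)
      have h5 : (2 - c) * ‖(Z ^ m) v - v‖ ≤ c * ((2 - c)⁻¹) ^ k * ‖v‖ := by linarith
      calc ‖(Z ^ m) v - v‖ ≤ (2 - c)⁻¹ * (c * ((2 - c)⁻¹) ^ k * ‖v‖) := by
            rwa [le_inv_mul_iff₀ hpos]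
        _ = c * ((2 - c)⁻¹) ^ (k + 1) * ‖v‖ := by ring
  ext v
  have hlim : Tendsto (fun k : ℕ => c * ((2 - c)⁻¹) ^ k * ‖v‖) atTop (𝓝 (c * 0 * ‖v‖)) :=
    ((tendsto_pow_atTop_nhds_zero_of_lt_one (inv_nonneg.2 hpos.le)
      (inv_lt_one_of_one_lt₀ (by linarith))).const_mul c).mul_const _
  have h := ge_of_tendsto' hlim fun k => by simpa using key k 1 v
  exact sub_eq_zero.1 (norm_le_zero_iff.1 (by simpa using h))

theorem commutatorElement_pow_left_of_commute {G : Type*} [Group G] {a x : G}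
    (h : Commute a ⁅a, x⁆) (m : ℕ) : ⁅a ^ m, x⁆ = ⁅a, x⁆ ^ m := by
  induction m with
  | zero => simp
  | succ m ih =>
    calc ⁅a ^ (m + 1), x⁆ = a * ⁅a ^ m, x⁆ * a⁻¹ * ⁅a, x⁆ := by
          simp only [commutatorElement_def]; rw [pow_succ']; group
      _ = ⁅a, x⁆ ^ (m + 1) := by
          rw [ih, (h.pow_right m).eq, mul_inv_cancel_right, pow_succ]

/-- This holds because every power of `⁅A, X⁆` is a commutator `⁅A ^ m, X⁆`, hence moves vectors at
most twice as far as `X` does. -/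
theorem commute_of_commute_commutator (hc : 2 * c < 1) (hX : MovesAtMost c X)
    (h : Commute A ⁅A, X⁆) : Commute A X := by
  rw [← commutatorElement_eq_one_iff_commute]
  refine eq_one_of_forall_movesAtMost_pow hc fun m => ?_
  rw [← commutatorElement_pow_left_of_commute h, two_mul, commutatorElement_def]
  exact (hX.conj _).mul hX.inv

theorem inner_map_sub_eq_zero {v : H} (hv : B v = v) (w : H) : inner ℝ v (B w - w) = 0 := by
  have h : inner ℝ (B v) (B w) = inner ℝ v w := B.inner_map_map v w
  rw [hv] at h
  rw [inner_sub_right, h, sub_self]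

/-- By compactness, any family of isometries of a finite-dimensional space can be coloured with
finitely many colours so that `(A i)⁻¹ * A j` is near the identity whenever `i` and `j` have the same
colour. -/
theorem exists_finite_range_movesAtMost [FiniteDimensional ℝ H] {ι : Type*}
    (A : ι → (H ≃ₗᵢ[ℝ] H)) (hc : 0 < c) :
    ∃ (T : Set (H →L[ℝ] H)) (f : ι → T), T.Finite ∧
      ∀ i j, f i = f j → MovesAtMost c ((A i)⁻¹ * A j) := by
  let F : ι → (H →L[ℝ] H) := fun i => (A i).toLinearIsometry.toContinuousLinearMap
  have : ProperSpace (H →L[ℝ] H) := FiniteDimensional.proper ℝ _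
  have htb : TotallyBounded (Metric.closedBall (0 : H →L[ℝ] H) 1) :=
    (isCompact_closedBall _ _).totallyBounded
  obtain ⟨T, hT, hcov⟩ := Metric.totallyBounded_iff.1 htb (c / 2) (by linarith)
  have hF : ∀ i, ∃ t : T, dist (F i) t < c / 2 := fun i => by
    have : F i ∈ Metric.closedBall (0 : H →L[ℝ] H) 1 := by
      rw [mem_closedBall_zero_iff]
      exact (A i).toLinearIsometry.norm_toContinuousLinearMap_le
    obtain ⟨t, ht, hit⟩ := Set.mem_iUnion₂.1 (hcov this)
    exact ⟨⟨t, ht⟩, hit⟩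
  choose f hf using hF
  refine ⟨T, f, hT, fun i j hij v => ?_⟩
  have h1 : ‖F j - F i‖ ≤ c := by
    rw [← dist_eq_norm]
    have h2 := hf i
    rw [hij] at h2
    linarith [dist_triangle_right (F j) (F i) (f j : H →L[ℝ] H), hf j]
  calc ‖(A i)⁻¹ (A j v) - v‖ = ‖A i ((A i)⁻¹ (A j v) - v)‖ :=
        (LinearIsometryEquiv.norm_map _ _).symm
    _ = ‖(F j - F i) v‖ := by
        have : A i ((A i)⁻¹ (A j v)) = A j v := (A i).apply_symm_apply _
        rw [map_sub, this]; rfl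
    _ ≤ c * ‖v‖ := (F j - F i).le_of_opNorm_le h1 v

end Isometries

/-! ### Cocycles -/

theorem IsStandardCocycleMap.comp_inv {G H : Type*} [Group G] [NormedAddCommGroup H]
    {b : G → H} (hb : IsStandardCocycleMap b) :
    IsStandardCocycleMap fun g => b g⁻¹ := by
  refine ⟨hb.1.comp inv_injective, hb.2.trans_le ?_⟩
  exact le_iInf fun g => le_iInf fun h => (iInf_le _ g⁻¹).trans (iInf_le _ h⁻¹)

section Cocycles

variable {G H : Type*} [Group G] [NormedAddCommGroup H] [InnerProductSpace ℝ H]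
  {α : G →* (H ≃ₗᵢ[ℝ] H)} {b : G → H} {g h t : G}

theorem IsRightCocycle.isLeftCocycle_comp_inv (hb : IsRightCocycle α b) :
    IsLeftCocycle α fun g => b g⁻¹ := fun g h => by
  simpa using hb g h⁻¹

namespace IsLeftCocycle

theorem map_mul (hb : IsLeftCocycle α b) (g h : G) : b (g * h) = b g + α g (b h) := by
  rw [hb g h]; abel

theorem map_one (hb : IsLeftCocycle α b) : b 1 = 0 := by
  simpa using hb 1 1

theorem exists_pos_eq_one_of_norm_lt (hb : IsLeftCocycle α b) (hs : IsStandardCocycleMap b) :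
    ∃ δ > 0, ∀ g, ‖b g‖ < δ → g = 1 := by
  obtain ⟨ε, hε0, hε⟩ := ENNReal.lt_iff_exists_real_btwn.1 hs.2
  obtain ⟨hε1, hε2⟩ := hε
  have hε3 : 0 < ε := ENNReal.ofReal_pos.1 hε1
  refine ⟨√ε, Real.sqrt_pos.2 hε3, fun g hg => ?_⟩
  by_contra hne
  have hbne : b g ≠ b 1 := fun h => hne (hs.1 h)
  have h1 : separationConst b ≤ ENNReal.ofReal (‖b g - b 1‖ ^ 2) :=
    (iInf_le _ g).trans ((iInf_le _ 1).trans (iInf_le _ hbne))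
  rw [hb.map_one, sub_zero] at h1
  have h2 : ‖b g‖ ^ 2 < ε := (Real.lt_sqrt (norm_nonneg _)).1 hg
  exact absurd (hε2.trans_le (h1.trans (ENNReal.ofReal_le_ofReal h2.le))) (lt_irrefl _)

theorem map_commutator (hb : IsLeftCocycle α b) (g x : G) :
    b ⁅g, x⁆ = (b g - (α g * α x * (α g)⁻¹) (b g)) + (α g (b x) - α ⁅g, x⁆ (b x)) := by
  have h1 : ⁅g, x⁆ * (x * g) = g * x := by rw [commutatorElement_def]; group
  have h2 : α ⁅g, x⁆ * α x = α g * α x * (α g)⁻¹ := by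
    rw [commutatorElement_def]; simp [mul_assoc]
  have h4 : α ⁅g, x⁆ (α x (b g)) = (α g * α x * (α g)⁻¹) (b g) := by rw [← h2]; rfl
  have h3 := congrArg b h1
  rw [hb.map_mul, hb.map_mul, hb.map_mul, map_add, h4] at h3
  rw [eq_sub_of_add_eq h3]; abel

/-- The rotation and translation parts of the iterated commutators `⁅g, ⁅g, … ⁅g, h⁆⁆⁆` both decay
geometrically when the rotation parts of `g` and `h` are near the identity. -/
theorem iterate_commutator_bound (hb : IsLeftCocycle α b) (hg : MovesAtMost (1 / 4) (α g))
    (hh : MovesAtMost (1 / 4) (α h)) (k : ℕ) :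
    MovesAtMost (1 / 4 * (1 / 2) ^ k) (α ((fun x => ⁅g, x⁆)^[k] h)) ∧
      ‖b ((fun x => ⁅g, x⁆)^[k] h)‖ ≤ (2 * ‖b g‖ + ‖b h‖) * (1 / 2) ^ k := by
  induction k with
  | zero => exact ⟨by simpa using hh, by simp⟩
  | succ k ih =>
    rw [Function.iterate_succ_apply']
    set x := (fun x => ⁅g, x⁆)^[k] h
    obtain ⟨hx, hbx⟩ := ih
    have hp : (0 : ℝ) ≤ (1 / 2) ^ k := by positivity
    have hp1 : ((1 : ℝ) / 2) ^ k ≤ 1 := pow_le_one₀ (by norm_num) (by norm_num)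
    have hy : MovesAtMost (1 / 4 * (1 / 2) ^ (k + 1)) (α ⁅g, x⁆) := by
      rw [map_commutatorElement]
      exact (MovesAtMost.commutator (by norm_num) (by positivity) hg hx).mono
        (by rw [pow_succ]; linarith)
    refine ⟨hy, ?_⟩
    have h1 := hx.conj (α g) (b g)
    have h2 := hg (b x)
    have h3 := (hy.mono (d := 1 / 8) (by rw [pow_succ]; linarith)) (b x)
    have h4 : ‖b ⁅g, x⁆‖ ≤ 1 / 4 * (1 / 2) ^ k * ‖b g‖ + (1 / 4 * ‖b x‖ + 1 / 8 * ‖b x‖) := by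
      rw [hb.map_commutator]
      refine (norm_add_le _ _).trans (add_le_add ?_ ?_)
      · rwa [norm_sub_rev]
      · calc ‖α g (b x) - α ⁅g, x⁆ (b x)‖
            = ‖(α g (b x) - b x) - (α ⁅g, x⁆ (b x) - b x)‖ := by congr 1; abel
          _ ≤ _ := (norm_sub_le _ _).trans (add_le_add h2 h3)
    have h5 : 0 ≤ ‖b h‖ * (1 / 2) ^ k := by positivity
    rw [pow_succ]
    -- The constant `M = 2 ‖b g‖ + ‖b h‖` satisfies `‖b g‖ / 4 + (3 / 8) M ≤ M / 2`.
    linarith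

theorem exists_iterate_commutator_eq_one (hb : IsLeftCocycle α b) (hs : IsStandardCocycleMap b)
    (hg : MovesAtMost (1 / 4) (α g)) (hh : MovesAtMost (1 / 4) (α h)) :
    ∃ k, (fun x => ⁅g, x⁆)^[k] h = 1 := by
  obtain ⟨δ, hδ, hsmall⟩ := hb.exists_pos_eq_one_of_norm_lt hs
  have hlim : Tendsto (fun k : ℕ => (2 * ‖b g‖ + ‖b h‖) * (1 / 2 : ℝ) ^ k) atTop
      (𝓝 ((2 * ‖b g‖ + ‖b h‖) * 0)) :=
    (tendsto_pow_atTop_nhds_zero_of_lt_one (by norm_num) (by norm_num)).const_mul _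
  rw [mul_zero] at hlim
  obtain ⟨k, hk⟩ := (hlim.eventually_lt_const hδ).exists
  exact ⟨k, hsmall _ ((hb.iterate_commutator_bound hg hh k).2.trans_lt hk)⟩

theorem commute_rotations (hb : IsLeftCocycle α b) (hs : IsStandardCocycleMap b)
    (hg : MovesAtMost (1 / 4) (α g)) (hh : MovesAtMost (1 / 4) (α h)) :
    Commute (α g) (α h) := by
  obtain ⟨k, hk⟩ := hb.exists_iterate_commutator_eq_one hs hg hh
  induction k generalizing h with
  | zero => simp_all
  | succ k ih =>
    have h1 := (hb.iterate_commutator_bound hg hh 1).1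
    refine commute_of_commute_commutator (by norm_num) hh ?_
    rw [← map_commutatorElement]
    exact ih (h1.mono (by norm_num)) hk

theorem map_rotation_eq_of_map_eq_one (hb : IsLeftCocycle α b) (hs : IsStandardCocycleMap b)
    (hg : MovesAtMost (1 / 4) (α g)) (ht : α t = 1) : α g (b t) = b t := by
  obtain ⟨k, hk⟩ := hb.exists_iterate_commutator_eq_one hs hg
    (h := t) (by rw [ht]; exact MovesAtMost.one (by norm_num))
  induction k generalizing t with
  | zero =>
    obtain rfl : t = 1 := hk
    simp [hb.map_one]
  | succ k ih =>
    have ht1 : α ⁅g, t⁆ = 1 := by simp [map_commutatorElement, ht]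
    have h1 : b ⁅g, t⁆ = α g (b t) - b t := by
      rw [hb.map_commutator, ht1, ht]; simp
    have h2 := ih ht1 hk
    -- `(α g - 1) (b t)` is fixed by `α g`, hence orthogonal to itself.
    have h3 := inner_map_sub_eq_zero h2 (b t)
    rw [h1] at h3
    exact sub_eq_zero.1 (inner_self_eq_zero.1 h3)

theorem commute_of_movesAtMost (hb : IsLeftCocycle α b) (hs : IsStandardCocycleMap b)
    (hg : MovesAtMost (1 / 4) (α g)) (hh : MovesAtMost (1 / 4) (α h)) : Commute g h := by
  have hcomm := hb.commute_rotations hs hg hh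
  have ht : α ⁅g, h⁆ = 1 := by
    rw [map_commutatorElement, commutatorElement_eq_one_iff_commute]; exact hcomm
  have h1 := hb.map_rotation_eq_of_map_eq_one hs hg ht
  have h2 := hb.map_rotation_eq_of_map_eq_one hs hh ht
  have h3 : b ⁅g, h⁆ = (α g (b h) - b h) - (α h (b g) - b g) := by
    rw [hb.map_commutator, ht, hcomm.eq, mul_inv_cancel_right, LinearIsometryEquiv.coe_one, id_eq]
    abel
  have h4 : inner ℝ (b ⁅g, h⁆) (b ⁅g, h⁆) = 0 := by
    nth_rw 2 [h3]
    rw [inner_sub_right, inner_map_sub_eq_zero h1, inner_map_sub_eq_zero h2, sub_zero]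
  rw [← commutatorElement_eq_one_iff_commute]
  exact hs.1 ((inner_self_eq_zero.1 h4).trans hb.map_one.symm)

/-- The abelian subgroup is generated by the elements whose rotation parts are near the identity. -/
theorem isVirtuallyAbelian [FiniteDimensional ℝ H] (hb : IsLeftCocycle α b)
    (hs : IsStandardCocycleMap b) : IsVirtuallyAbelian G := by
  let S : Set G := {g | MovesAtMost (1 / 4) (α g)}
  refine ⟨Subgroup.closure S, fun x hx y hy => ?_, ?_⟩
  · induction hx, hy using Subgroup.closure_induction₂ with
    | mem x y hx hy => exact hb.commute_of_movesAtMost hs hx hy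
    | one_left y _ => simp
    | one_right x _ => simp
    | mul_left x y z _ _ _ h1 h2 => exact Commute.mul_left h1 h2
    | mul_right x y z _ _ _ h1 h2 => exact Commute.mul_right h1 h2
    | inv_left x y _ _ h => exact Commute.inv_left h
    | inv_right x y _ _ h => exact Commute.inv_right h
  · obtain ⟨T, f, hT, hf⟩ := exists_finite_range_movesAtMost α (c := 1 / 4) (by norm_num)
    have : Finite T := hT
    have hinj : Function.Injective fun q : G ⧸ Subgroup.closure S => f q.out := fun p q hpq => by
      have h1 := hf _ _ hpq
      rw [← map_inv, ← _root_.map_mul] at h1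
      rw [← QuotientGroup.out_eq' p, ← QuotientGroup.out_eq' q]
      exact QuotientGroup.eq.2 (Subgroup.subset_closure h1)
    have : Finite (G ⧸ Subgroup.closure S) := Finite.of_injective _ hinj
    exact Subgroup.finiteIndex_of_finite_quotient

end IsLeftCocycle

end Cocycles

theorem theorem5p6 {G : Type*} [Group G]
    {H : Type*} [NormedAddCommGroup H] [InnerProductSpace ℝ H] [FiniteDimensional ℝ H]
    (α : G →* (H ≃ₗᵢ[ℝ] H)) (b : G → H)
    (hcocycle : IsLeftCocycle α b ∨ IsRightCocycle α b)
    (hstandard : IsStandardCocycleMap b) :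
    IsVirtuallyAbelian G := by
  rcases hcocycle with hb | hb
  · exact hb.isVirtuallyAbelian hstandard
  · exact hb.isLeftCocycle_comp_inv.isVirtuallyAbelian hstandard.comp_inv
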